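/- Let $K$ be a field of characteristic $0$ and let $R=K[x_0,x_1,x_2,x_3]$ be the homogeneous coordinate ring of $\mathbb P^3=\mathbb P^3_K$. For a set $V$ of ($K$-rational) points of $\mathbb P^3$ let $I_V\subset R$ be the ideal generated by the homogeneous polynomials vanishing at all points of $V$, write $I_P=I_{\{P\}}$ for a point $P$, and for a homogeneous ideal $I$ let $[I]_d$ be the $K$-vector space of its elements that are homogeneous of degree $d$. For an integer $d\ge 1$, a finite set $Z\subset\mathbb P^3$ has the unexpected cone property $C(d)$ if, for a general point $P\in\mathbb P^3$ (that is, for all $K$-rational points $P$ of some nonempty Zariski open subset), $$\dim_K [I_Z\cap I_P^d]_d>\max\left\{0,\ \dim_K [I_Z]_d-\binom{d+2}{3}\right\}.$$ Proposition. Let $Z\subset\mathbb P^3$ be a finite set of at least $6$ ($K$-rational) points that is non-degenerate, i.e. not contained in a plane. Then $Z$ has property $C(2)$ if and only if there are two skew (i.e. disjoint) lines $L_1,L_2\subset\mathbb P^3$ such that $Z\subset L_1\cup L_2$ and each of $L_1$, $L_2$ contains at least $3$ points of $Z$. -/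

import Mathlib

open scoped LinearAlgebra.Projectivization

namespace UnexpectedCones

noncomputable section

/-- The projective space `ℙⁿ` over `K`, as the set of lines through the origin of `Kⁿ⁺¹`. -/
abbrev PSpace (K : Type*) [Field K] (n : ℕ) : Type _ := ℙ K (Fin (n + 1) → K)

/-- The form `f` vanishes at the point `P`. For homogeneous `f`, the only ones to which this is
applied, it does not depend on the representative of `P`. -/
def VanishesAt {K : Type*} [Field K] {n : ℕ} (f : MvPolynomial (Fin (n + 1)) K)
    (P : PSpace K n) : Prop :=
  MvPolynomial.eval P.rep f = 0

/-- The homogeneous ideal `I_V` of a set of points `V ⊆ ℙⁿ`: it is generated by the homogeneous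
polynomials that vanish at all points of `V`. -/
def idealOf {K : Type*} [Field K] {n : ℕ} (V : Set (PSpace K n)) :
    Ideal (MvPolynomial (Fin (n + 1)) K) :=
  Ideal.span {f | (∃ d : ℕ, f.IsHomogeneous d) ∧ ∀ P ∈ V, VanishesAt f P}

/-- The degree `d` component `[I]_d` of an ideal of the polynomial ring, as a `K`-vector space. -/
def degreePart {K : Type*} [Field K] {n : ℕ} (I : Ideal (MvPolynomial (Fin (n + 1)) K)) (d : ℕ) :
    Submodule K (MvPolynomial (Fin (n + 1)) K) :=
  I.restrictScalars K ⊓ MvPolynomial.homogeneousSubmodule (Fin (n + 1)) K d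

/-- `dim [I]_d`; the space is finite dimensional, being contained in the space of forms of
degree `d` in finitely many variables. -/
def dimPart {K : Type*} [Field K] {n : ℕ} (I : Ideal (MvPolynomial (Fin (n + 1)) K)) (d : ℕ) : ℕ :=
  Module.finrank K (degreePart I d)

/-- `U ⊆ ℙⁿ` is Zariski open: it is the complement of the common zero locus of a set of
homogeneous polynomials. -/
def IsZariskiOpen {K : Type*} [Field K] {n : ℕ} (U : Set (PSpace K n)) : Prop :=
  ∃ S : Set (MvPolynomial (Fin (n + 1)) K),
    (∀ f ∈ S, ∃ d : ℕ, f.IsHomogeneous d) ∧ U = {P | ∀ f ∈ S, VanishesAt f P}ᶜ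

/-- A property holds for a general point of `ℙⁿ`: it holds at every point of some nonempty
Zariski open subset. -/
def ForGeneralPoint {K : Type*} [Field K] {n : ℕ} (p : PSpace K n → Prop) : Prop :=
  ∃ U : Set (PSpace K n), IsZariskiOpen U ∧ U.Nonempty ∧ ∀ P ∈ U, p P

/-- `V` admits an unexpected hypersurface of degree `d` and multiplicity `m`: for a general point
`P`, one has `dim [I_V ∩ I_P^m]_d > max {0, dim [I_V]_d - binom (m-1+n) n}`. The difference is
taken in `ℤ`; the binomial coefficient is meant for `m ≥ 1`. -/
def AdmitsUnexpected {K : Type*} [Field K] {n : ℕ} (V : Set (PSpace K n)) (d m : ℕ) : Prop :=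
  ForGeneralPoint fun P : PSpace K n =>
    max 0 ((dimPart (idealOf V) d : ℤ) - ((m - 1 + n).choose n : ℤ)) <
      (dimPart (idealOf V ⊓ idealOf {P} ^ m) d : ℤ)

/-- The unexpected cone property `C(d)` of a set of points of `ℙ³` (for `d ≥ 1`). -/
def UnexpectedConeProperty {K : Type*} [Field K] (Z : Set (PSpace K 3)) (d : ℕ) : Prop :=
  AdmitsUnexpected Z d d

/-- The point `P` lies on the linear subspace of `ℙⁿ` given by the vector subspace `W`. -/
def LiesOn {K : Type*} [Field K] {n : ℕ} (P : PSpace K n)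
    (W : Submodule K (Fin (n + 1) → K)) : Prop :=
  P.submodule ≤ W

/-- A set of points of `ℙⁿ` is non-degenerate if it is not contained in a hyperplane. -/
def IsNondegenerate {K : Type*} [Field K] {n : ℕ} (V : Set (PSpace K n)) : Prop :=
  ¬ ∃ H : Submodule K (Fin (n + 1) → K), Module.finrank K H = n ∧ ∀ P ∈ V, LiesOn P H

/-- `W` is (the vector subspace of dimension two belonging to) a line of `ℙ³`. -/
def IsLine {K : Type*} [Field K] (W : Submodule K (Fin (3 + 1) → K)) : Prop :=
  Module.finrank K W = 2

/-- Two lines of `ℙ³` are skew if they have no common point. -/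
def AreSkew {K : Type*} [Field K] (L₁ L₂ : Submodule K (Fin (3 + 1) → K)) : Prop :=
  ∀ P : PSpace K 3, ¬ (LiesOn P L₁ ∧ LiesOn P L₂)

end

end UnexpectedCones

namespace UnexpectedCones

open MvPolynomial Module

/-! ### Graded pieces of the ideals as vanishing conditions -/

section Ideals

variable {K : Type*} [Field K] {n : ℕ}

/-! In characteristic 0 a quadratic form is determined by its Hessian bilinear form. A point lies on
the quadric when it is isotropic, and the quadric is a cone with vertex `P` when `P` lies in the
radical, so everything becomes linear algebra with symmetric 4 by 4 matrices.

Forward direction. Non-degeneracy lets four points of `Z` serve as a coordinate basis, and at least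
two points of `Z` remain. Cones through the coordinate points with vertex `p` off the coordinate
planes form a pencil (`cone_matrix_opposite`), and each further point of `Z` imposes one linear
equation on its two parameters. For two further points `z`, `w` a cone exists only if the 2 by 2
determinant, the Weddle quartic in `p`, vanishes. Since `p` is general, the quartic is identically
zero (`weddle_eq_zero_of_unexpectedConeProperty`). Its coefficients (`weddle_coeff`) then force `z`
onto a coordinate line and `w` onto the same line or the opposite one (`support_of_weddle`). This
places `Z` on two opposite edges of the tetrahedron, the first of which has three points. If the
second had only its two coordinate points, quadrics through `Z` would have dimension at least 5 and
cones at most 1, which is no more than expected; hence it has a third point.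

Converse. Three points on each line force a quadric through `Z` to contain both lines. Such quadrics
have dimension at most 4, so the expected dimension of cones is 0. Yet the union of two planes
through `P`, each containing one of the lines, is always a cone. -/

theorem eval_smul_of_isHomogeneous {f : MvPolynomial (Fin (n + 1)) K} {d : ℕ}
    (hf : f.IsHomogeneous d) (c : K) (x : Fin (n + 1) → K) :
    eval (c • x) f = c ^ d * eval x f := by
  rw [eval_eq, eval_eq, Finset.mul_sum]
  refine Finset.sum_congr rfl fun m hm => ?_
  have h : ∑ i, m i = d := by
    have := hf (mem_support_iff.mp hm)
    rwa [Finsupp.weight_apply, Finsupp.sum_fintype _ _ (by simp),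
      Finset.sum_congr rfl fun i _ => by rw [Pi.one_apply, smul_eq_mul, mul_one]] at this
  have h2 : ∀ y : Fin (n + 1) → K, ∏ i ∈ m.support, y i ^ m i = ∏ i, y i ^ m i := fun y =>
    Finset.prod_subset (Finset.subset_univ _) fun i _ hi => by
      rw [Finsupp.notMem_support_iff.mp hi, pow_zero]
  rw [h2, h2]
  simp only [Pi.smul_apply, smul_eq_mul, mul_pow, Finset.prod_mul_distrib,
    Finset.prod_pow_eq_pow_sum, h]
  ring

/-- Evaluation at a fixed representative is a ring homomorphism killing the generators, so
membership in the ideal is nothing more than vanishing at the points. -/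
theorem mem_degreePart_idealOf {V : Set (PSpace K n)} {d : ℕ}
    {f : MvPolynomial (Fin (n + 1)) K} :
    f ∈ degreePart (idealOf V) d ↔ f.IsHomogeneous d ∧ ∀ P ∈ V, eval P.rep f = 0 := by
  constructor
  · rintro ⟨h1, h2⟩
    refine ⟨h2, fun P hP => ?_⟩
    have h3 : idealOf V ≤ RingHom.ker (eval P.rep) := Ideal.span_le.mpr fun g hg => hg.2 P hP
    exact h3 h1
  · rintro ⟨h1, h2⟩
    exact ⟨Ideal.subset_span ⟨⟨d, h1⟩, h2⟩, h1⟩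

/-- By the Leibniz rule, each term of the derivative of a product of two elements of the ideal keeps
a factor vanishing at the point. -/
theorem eval_pderiv_of_mem_sq {P : PSpace K n} {f : MvPolynomial (Fin (n + 1)) K}
    (hf : f ∈ idealOf {P} ^ 2) (i : Fin (n + 1)) : eval P.rep (pderiv i f) = 0 := by
  have h3 : idealOf {P} ≤ RingHom.ker (eval P.rep) := Ideal.span_le.mpr fun g hg => hg.2 P rfl
  rw [pow_two] at hf
  refine Submodule.mul_induction_on hf (fun a ha b hb => ?_) fun a b ha hb => ?_
  · have ha' : eval P.rep a = 0 := h3 ha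
    have hb' : eval P.rep b = 0 := h3 hb
    simp [ha', hb']
  · rw [map_add, map_add, ha, hb, add_zero]

theorem liesOn_iff {P : PSpace K n} {W : Submodule K (Fin (n + 1) → K)} :
    LiesOn P W ↔ P.rep ∈ W := by
  rw [LiesOn, Projectivization.submodule_eq, Submodule.span_singleton_le_iff_mem]

theorem rep_ne_smul_rep {P Q : PSpace K n} (h : P ≠ Q) (c : K) : P.rep ≠ c • Q.rep := by
  intro hc
  apply h
  rw [← P.mk_rep, ← Q.mk_rep, Projectivization.mk_eq_mk_iff']
  exact ⟨c, hc.symm⟩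

end Ideals

/-! ### Quadratic forms through their Hessians -/

section Hessian

variable {K : Type*} [Field K] {n : ℕ}

theorem pderiv_comm {σ R : Type*} [CommRing R] (i j : σ) (f : MvPolynomial σ R) :
    pderiv i (pderiv j f) = pderiv j (pderiv i f) := by
  classical
  have h : ⁅(pderiv i : Derivation R (MvPolynomial σ R) (MvPolynomial σ R)),
      (pderiv j : Derivation R (MvPolynomial σ R) (MvPolynomial σ R))⁆ = 0 := by
    refine derivation_ext fun k => ?_
    rw [Derivation.commutator_apply, pderiv_X, pderiv_X, Pi.single_apply, Pi.single_apply]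
    split_ifs <;> simp
  have := congrArg (fun D => D f) h
  rwa [Derivation.commutator_apply, Derivation.zero_apply, sub_eq_zero] at this

/-- The Hessian form at the origin of a polynomial; for a quadratic form this is twice the
associated symmetric bilinear form. -/
noncomputable def hess :
    MvPolynomial (Fin (n + 1)) K →ₗ[K] LinearMap.BilinForm K (Fin (n + 1) → K) :=
  (Matrix.toBilin' : Matrix (Fin (n + 1)) (Fin (n + 1)) K ≃ₗ[K] _).toLinearMap ∘ₗ
    { toFun := fun f => Matrix.of fun i j => eval 0 (pderiv j (pderiv i f))
      map_add' := fun f g => by ext; simp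
      map_smul' := fun c f => by ext; simp }

theorem hess_apply (f : MvPolynomial (Fin (n + 1)) K) (u v : Fin (n + 1) → K) :
    hess f u v = ∑ i, ∑ j, u i * eval 0 (pderiv j (pderiv i f)) * v j := by
  simp [hess, Matrix.toBilin'_apply]

theorem hess_comm (f : MvPolynomial (Fin (n + 1)) K) (u v : Fin (n + 1) → K) :
    hess f u v = hess f v u := by
  rw [hess_apply, hess_apply, Finset.sum_comm]
  refine Finset.sum_congr rfl fun i _ => Finset.sum_congr rfl fun j _ => ?_
  rw [pderiv_comm]
  ring

/-- Euler's identity for the linear forms `pderiv i f`, whose own derivatives are constants, so that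
evaluating them at 0 loses nothing. -/
theorem hess_eq_sum_pderiv {f : MvPolynomial (Fin (n + 1)) K} (hf : f.IsHomogeneous 2)
    (u v : Fin (n + 1) → K) : hess f u v = ∑ i, u i * eval v (pderiv i f) := by
  rw [hess_apply]
  refine Finset.sum_congr rfl fun i _ => ?_
  have h1 : (pderiv i f).IsHomogeneous 1 := hf.pderiv
  have h2 := congrArg (eval v) h1.sum_X_mul_pderiv
  rw [one_smul, map_sum] at h2
  rw [← h2, Finset.mul_sum]
  refine Finset.sum_congr rfl fun j _ => ?_
  have h3 : (pderiv j (pderiv i f)).IsHomogeneous 0 := h1.pderiv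
  rw [← totalDegree_zero_iff_isHomogeneous, totalDegree_eq_zero_iff_eq_C] at h3
  rw [h3]
  simp
  ring

theorem hess_self {f : MvPolynomial (Fin (n + 1)) K} (hf : f.IsHomogeneous 2)
    (u : Fin (n + 1) → K) : hess f u u = 2 * eval u f := by
  have := congrArg (eval u) hf.sum_X_mul_pderiv
  rw [hess_eq_sum_pderiv hf]
  simpa using this

/-- This is how the double point enters: the vertex of a quadric cone lies in the radical of its
bilinear form. -/
theorem hess_rep_of_mem_sq {P : PSpace K n} {f : MvPolynomial (Fin (n + 1)) K}
    (hf : f.IsHomogeneous 2) (hP : f ∈ idealOf {P} ^ 2) (v : Fin (n + 1) → K) :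
    hess f P.rep v = 0 := by
  rw [hess_comm, hess_eq_sum_pderiv hf]
  exact Finset.sum_eq_zero fun i _ => by rw [eval_pderiv_of_mem_sq hP, mul_zero]

variable [CharZero K]

theorem eq_zero_of_hess_eq_zero {f : MvPolynomial (Fin (n + 1)) K} (hf : f.IsHomogeneous 2)
    (h : hess f = 0) : f = 0 := by
  refine MvPolynomial.funext fun x => ?_
  have := hess_self hf x
  rw [h] at this
  simpa using this.symm

theorem eq_zero_of_hess_basis {ι : Type*} (b : Basis ι K (Fin (n + 1) → K))
    {f : MvPolynomial (Fin (n + 1)) K} (hf : f.IsHomogeneous 2)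
    (h : ∀ i j, hess f (b i) (b j) = 0) : f = 0 :=
  eq_zero_of_hess_eq_zero hf <| LinearMap.BilinForm.ext_basis b fun i j => by simp [h]

/-- Needed for lower bounds on `finrank`, which would be 0 by convention on an infinite-dimensional
space. -/
instance finite_degreePart_two (I : Ideal (MvPolynomial (Fin (n + 1)) K)) :
    Module.Finite K (degreePart I 2) :=
  Module.Finite.of_injective (hess.domRestrict (degreePart I 2)) <| by
    rw [injective_iff_map_eq_zero]
    rintro ⟨f, hf⟩ h
    exact Subtype.ext (eq_zero_of_hess_eq_zero hf.2 h)

end Hessian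

/-! ### General points in coordinates -/

section General

variable {K : Type*} [Field K] [CharZero K] {n : ℕ} {ι : Type*} [Fintype ι]

/-- A nonempty Zariski open set is not contained in a hypersurface, in coordinates with respect to
any basis. -/
theorem exists_mem_of_isZariskiOpen {U : Set (PSpace K n)} (hU : IsZariskiOpen U)
    (hne : U.Nonempty) (b : Basis ι K (Fin (n + 1) → K)) {g : MvPolynomial ι K} (hg : g ≠ 0)
    (i₀ : ι) :
    ∃ p : ι → K, ∃ P ∈ U, ∃ c : K, P.rep = c • ∑ i, p i • b i ∧ c ≠ 0 ∧ eval p g ≠ 0 := by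
  obtain ⟨S, hS, rfl⟩ := hU
  obtain ⟨P₀, hP₀⟩ := hne
  simp only [Set.mem_compl_iff, Set.mem_ofPred_eq, not_forall] at hP₀
  obtain ⟨f, hfS, hf⟩ := hP₀
  obtain ⟨d, hd⟩ := hS f hfS
  let F : MvPolynomial ι K := bind₁ (fun j => ∑ i, C (b i j) * X i) f
  have hF : ∀ p : ι → K, eval p F = eval (∑ i, p i • b i) f := fun p => by
    simp only [F, eval, eval₂Hom_bind₁]
    congr 2
    funext j
    simp [mul_comm]
  have hF0 : F ≠ 0 := fun h => hf <| by
    have := hF (b.repr P₀.rep)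
    rw [b.sum_repr, h, map_zero] at this
    exact this.symm
  -- The factor `X i₀` makes the coordinate vector nonzero, so that it defines a projective point;
  -- `F` places that point in the open set. A nonzero polynomial over the infinite field `K` has a
  -- nonzero value.
  have hprod : X i₀ * F * g ≠ 0 := mul_ne_zero (mul_ne_zero (X_ne_zero _) hF0) hg
  obtain ⟨p, hp⟩ : ∃ p, eval p (X i₀ * F * g) ≠ 0 := by
    by_contra! h
    exact hprod (MvPolynomial.funext fun x => by rw [h, map_zero])
  rw [map_mul, map_mul, eval_X] at hp
  have hx : ∑ i, p i • b i ≠ 0 := fun h => by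
    have := Fintype.linearIndependent_iff.mp b.linearIndependent p h i₀
    rw [this, zero_mul, zero_mul] at hp
    exact hp rfl
  obtain ⟨c, hc⟩ := Projectivization.exists_smul_eq_mk_rep K _ hx
  refine ⟨p, Projectivization.mk K _ hx, ?_, c, hc.symm, c.ne_zero, right_ne_zero_of_mul hp⟩
  intro h
  have h2 := h f hfS
  rw [VanishesAt, ← hc, Units.smul_def, eval_smul_of_isHomogeneous hd, ← hF] at h2
  exact (mul_ne_zero (pow_ne_zero _ c.ne_zero)
    (right_ne_zero_of_mul (left_ne_zero_of_mul hp))) h2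

end General

/-! ### The pencil of cones and the Weddle surface -/

section Weddle

/-- The first of the two conditions imposed by `z` on the pencil of quadric cones with vertex `p`
through the coordinate points. -/
def coneCoeffA {R : Type*} [CommRing R] (z p : Fin 4 → R) : R :=
  z 0 * z 1 * p 2 * p 3 + z 2 * z 3 * p 0 * p 1 - z 0 * z 3 * p 1 * p 2 - z 1 * z 2 * p 0 * p 3

/-- The second of the two conditions imposed by `z` on the pencil of quadric cones with vertex `p`
through the coordinate points. -/
def coneCoeffB {R : Type*} [CommRing R] (z p : Fin 4 → R) : R :=
  z 0 * z 2 * p 1 * p 3 + z 1 * z 3 * p 0 * p 2 - z 0 * z 3 * p 1 * p 2 - z 1 * z 2 * p 0 * p 3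

/-- The equation in `p` of the Weddle surface of the coordinate points and `z`, `w`. -/
def weddle {R : Type*} [CommRing R] (z w p : Fin 4 → R) : R :=
  coneCoeffA z p * coneCoeffB w p - coneCoeffA w p * coneCoeffB z p

variable {K : Type*} [Field K] [CharZero K]

/-- The rescaled matrix `a i j * p i * p j` is symmetric with zero diagonal and zero row sums.
Signed combinations of the four row sums show that entries on opposite edges of the tetrahedron
agree, and the first row gives the last relation; two free parameters remain. -/
theorem cone_matrix_opposite {a : Fin 4 → Fin 4 → K} (hs : ∀ i j, a i j = a j i)
    (hd : ∀ i, a i i = 0) {p : Fin 4 → K} (hc : ∀ i, ∑ j, a i j * p j = 0) :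
    a 2 3 * p 2 * p 3 = a 0 1 * p 0 * p 1 ∧ a 1 3 * p 1 * p 3 = a 0 2 * p 0 * p 2 ∧
      a 1 2 * p 1 * p 2 = a 0 3 * p 0 * p 3 ∧
      a 0 1 * p 0 * p 1 + a 0 2 * p 0 * p 2 + a 0 3 * p 0 * p 3 = 0 := by
  have h0 := hc 0
  have h1 := hc 1
  have h2 := hc 2
  have h3 := hc 3
  simp only [Fin.sum_univ_four, hd, hs 1 0, hs 2 0, hs 3 0, hs 2 1, hs 3 1, hs 3 2] at h0 h1 h2 h3
  refine ⟨?_, ?_, ?_, ?_⟩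
  · linear_combination (-(p 0) * h0 - p 1 * h1 + p 2 * h2 + p 3 * h3) / 2
  · linear_combination (-(p 0) * h0 + p 1 * h1 - p 2 * h2 + p 3 * h3) / 2
  · linear_combination (-(p 0) * h0 + p 1 * h1 + p 2 * h2 - p 3 * h3) / 2
  · linear_combination p 0 * h0

/-- The rescaled entries at 01 and 02 solve two homogeneous linear equations, one for `z` and one
for `w`, with determinant `weddle z w p`. By Cramer's rule a nonzero determinant kills both entries,
and with them the whole matrix. -/
theorem weddle_eq_zero_of_cone {a : Fin 4 → Fin 4 → K} (hs : ∀ i j, a i j = a j i)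
    (hd : ∀ i, a i i = 0) (ha : ∃ i j, a i j ≠ 0) {p : Fin 4 → K} (hp : ∀ i, p i ≠ 0)
    (hc : ∀ i, ∑ j, a i j * p j = 0) {z w : Fin 4 → K}
    (hz : ∑ i, ∑ j, z i * z j * a i j = 0) (hw : ∑ i, ∑ j, w i * w j * a i j = 0) :
    weddle z w p = 0 := by
  obtain ⟨h1, h2, h3, h4⟩ := cone_matrix_opposite hs hd hc
  have key : ∀ y : Fin 4 → K, ∑ i, ∑ j, y i * y j * a i j = 0 →
      a 0 1 * p 0 * p 1 * coneCoeffA y p + a 0 2 * p 0 * p 2 * coneCoeffB y p = 0 := by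
    intro y hy
    simp only [Fin.sum_univ_four, hd, hs 1 0, hs 2 0, hs 3 0, hs 2 1, hs 3 1, hs 3 2] at hy
    simp only [coneCoeffA, coneCoeffB]
    linear_combination (p 0 * p 1 * p 2 * p 3 / 2) * hy - y 2 * y 3 * p 0 * p 1 * h1
      - y 1 * y 3 * p 0 * p 2 * h2 - y 1 * y 2 * p 0 * p 3 * h3
      - (y 0 * y 3 * p 1 * p 2 + y 1 * y 2 * p 0 * p 3) * h4
  have hz' := key z hz
  have hw' := key w hw
  have e1 : a 0 1 * p 0 * p 1 * weddle z w p = 0 := by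
    rw [weddle]
    linear_combination coneCoeffB w p * hz' - coneCoeffB z p * hw'
  have e2 : a 0 2 * p 0 * p 2 * weddle z w p = 0 := by
    rw [weddle]
    linear_combination coneCoeffA z p * hw' - coneCoeffA w p * hz'
  by_contra hW
  have a01 : a 0 1 = 0 := by simpa [hp, hW] using e1
  have a02 : a 0 2 = 0 := by simpa [hp, hW] using e2
  have a03 : a 0 3 = 0 := by simpa [hp, a01, a02] using h4
  have a23 : a 2 3 = 0 := by simpa [hp, a01] using h1
  have a13 : a 1 3 = 0 := by simpa [hp, a02] using h2
  have a12 : a 1 2 = 0 := by simpa [hp, a03] using h3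
  obtain ⟨i, j, hij⟩ := ha
  apply hij
  fin_cases i <;> fin_cases j <;> simp [hs 1 0, hs 2 0, hs 3 0, hs 2 1, hs 3 1, hs 3 2, *]

omit [CharZero K] in
theorem eval_weddle (z w p : Fin 4 → K) :
    eval p (weddle (fun i => C (z i)) (fun i => C (w i)) X) = weddle z w p := by
  simp [weddle, coneCoeffA, coneCoeffB]

/-- If all points lie on the Weddle surface of `z` and `w`, then all coefficients of its equation
vanish. -/
theorem weddle_coeff {z w : Fin 4 → K} (h : ∀ p, weddle z w p = 0) {l j k : Fin 4} (hj : j ≠ l)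
    (hk : k ≠ l) : z l * w l * (z j * w k - z k * w j) = 0 := by
  simp only [weddle, coneCoeffA, coneCoeffB] at h
  wlog hjk : j < k generalizing j k
  · rcases (not_lt.mp hjk).eq_or_lt with rfl | hlt
    · ring
    · linear_combination -(this hk hj hlt)
  -- On the face `p l = 0` the quartic is, up to sign, `z l * w l` times the product of the other
  -- three coordinates times the 3 by 3 determinant of `z`, `w`, `p` with coordinate `l` deleted.
  -- Adding the values at the all-ones point and at a point with one sign flipped isolates one 2 by
  -- 2 minor.
  have c1 := h ![0, 1, 1, 1]
  have c2 := h ![0, -1, 1, 1]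
  have c3 := h ![0, 1, -1, 1]
  have c4 := h ![0, 1, 1, -1]
  have d1 := h ![1, 0, 1, 1]
  have d2 := h ![-1, 0, 1, 1]
  have d3 := h ![1, 0, -1, 1]
  have d4 := h ![1, 0, 1, -1]
  have e1 := h ![1, 1, 0, 1]
  have e2 := h ![-1, 1, 0, 1]
  have e3 := h ![1, -1, 0, 1]
  have e4 := h ![1, 1, 0, -1]
  have f1 := h ![1, 1, 1, 0]
  have f2 := h ![-1, 1, 1, 0]
  have f3 := h ![1, -1, 1, 0]
  have f4 := h ![1, 1, -1, 0]
  clear h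
  simp only [Matrix.cons_val] at c1 c2 c3 c4 d1 d2 d3 d4 e1 e2 e3 e4 f1 f2 f3 f4
  fin_cases l <;> fin_cases j <;> fin_cases k <;>
    first
    | exact absurd rfl hj
    | exact absurd rfl hk
    | exact absurd hjk (by decide)
    | simp only [Fin.mk_one, Fin.reduceFinMk, Fin.isValue, Fin.zero_eta]
  · linear_combination (c1 + c4) / 2
  · linear_combination -(c1 + c3) / 2
  · linear_combination (c1 + c2) / 2
  · linear_combination -(d1 + d4) / 2
  · linear_combination (d1 + d3) / 2
  · linear_combination -(d1 + d2) / 2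
  · linear_combination (e1 + e4) / 2
  · linear_combination -(e1 + e3) / 2
  · linear_combination (e1 + e2) / 2
  · linear_combination -(f1 + f4) / 2
  · linear_combination (f1 + f3) / 2
  · linear_combination -(f1 + f2) / 2

/-- The position of two points on a common Weddle surface filling the space. -/
theorem support_of_weddle {z w : Fin 4 → K}
    (h : ∀ l j k : Fin 4, j ≠ l → k ≠ l → z l * w l * (z j * w k - z k * w j) = 0)
    (hzw : ∀ c : K, ∃ i, w i ≠ c * z i) (hw : ∀ l, ∃ i, i ≠ l ∧ w i ≠ 0)
    (h0 : z 0 ≠ 0) (h1 : z 1 ≠ 0) :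
    (z 2 = 0 ∧ z 3 = 0) ∧ ((w 2 = 0 ∧ w 3 = 0) ∨ (w 0 = 0 ∧ w 1 = 0)) := by
  have key : ∀ l j k : Fin 4, j ≠ l → k ≠ l → z l ≠ 0 → w l ≠ 0 → z j * w k = z k * w j := by
    intro l j k hj hk hz hw
    have := h l j k hj hk
    simpa [hz, hw, sub_eq_zero] using this
  have w0 := hw 0
  have w1 := hw 1
  have w2 := hw 2
  have w3 := hw 3
  have c0 := hzw (w 0 / z 0)
  simp only [Fin.exists_fin_succ, IsEmpty.exists_iff] at w0 w1 w2 w3 c0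
  simp at w0 w1 w2 w3 c0
  have k0 : w 0 ≠ 0 → z 1 * w 2 = z 2 * w 1 ∧ z 1 * w 3 = z 3 * w 1 := fun hh =>
    ⟨key 0 1 2 (by decide) (by decide) h0 hh, key 0 1 3 (by decide) (by decide) h0 hh⟩
  have k1 : w 1 ≠ 0 → z 0 * w 2 = z 2 * w 0 ∧ z 0 * w 3 = z 3 * w 0 := fun hh =>
    ⟨key 1 0 2 (by decide) (by decide) h1 hh, key 1 0 3 (by decide) (by decide) h1 hh⟩
  have k2 : z 2 ≠ 0 → w 2 ≠ 0 → z 0 * w 1 = z 1 * w 0 ∧ z 0 * w 3 = z 3 * w 0 := fun h2 hh =>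
    ⟨key 2 0 1 (by decide) (by decide) h2 hh, key 2 0 3 (by decide) (by decide) h2 hh⟩
  have k3 : z 3 ≠ 0 → w 3 ≠ 0 → z 0 * w 1 = z 1 * w 0 ∧ z 0 * w 2 = z 2 * w 0 := fun h2 hh =>
    ⟨key 3 0 1 (by decide) (by decide) h2 hh, key 3 0 2 (by decide) (by decide) h2 hh⟩
  have c1 : z 0 * w 1 = z 1 * w 0 → z 0 * w 2 = z 2 * w 0 → z 0 * w 3 = z 3 * w 0 → False := by
    intro e1 e2 e3
    rcases c0 with c0 | c0 | c0 | c0 <;> apply c0 <;> field_simp <;>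
      first | linear_combination e1 | linear_combination e2 | linear_combination e3
  clear key h hzw hw c0
  -- If `w 1 = 0`, the minors in `k0` give `w 2 = w 3 = 0`, and `w` would be a coordinate point.
  have w01 : w 0 ≠ 0 → w 1 ≠ 0 := by grind
  have w10 : w 1 ≠ 0 → w 0 ≠ 0 := by grind
  by_cases hw0 : w 0 = 0
  · have hw1 : w 1 = 0 := by_contra fun h => w10 h hw0
    grind
  · obtain ⟨i1, i2⟩ := k0 hw0
    obtain ⟨j1, j2⟩ := k1 (w01 hw0)
    -- Otherwise `w 2 ≠ 0` by `i1`, and then `k2` supplies the remaining minors that make `z` and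
    -- `w` proportional.
    have z2 : z 2 = 0 := by grind
    have z3 : z 3 = 0 := by grind
    rw [z2, zero_mul] at j1
    rw [z3, zero_mul] at j2
    exact ⟨⟨z2, z3⟩, Or.inl ⟨by simpa [h0] using j1, by simpa [h0] using j2⟩⟩

end Weddle

/-! ### Hessians and linear forms with respect to a basis -/

section Basis

variable {K : Type*} [Field K] {n : ℕ}

theorem hess_sum {ι : Type*} [Fintype ι] (b : ι → Fin (n + 1) → K)
    (f : MvPolynomial (Fin (n + 1)) K) (x y : ι → K) :
    hess f (∑ i, x i • b i) (∑ j, y j • b j) = ∑ i, ∑ j, x i * y j * hess f (b i) (b j) := by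
  simp only [map_sum, map_smul, LinearMap.sum_apply, LinearMap.smul_apply, smul_eq_mul,
    Finset.mul_sum]
  rw [Finset.sum_comm]
  exact Finset.sum_congr rfl fun i _ => Finset.sum_congr rfl fun j _ => by ring

theorem hess_eq_sum_repr {ι : Type*} [Fintype ι] (b : Basis ι K (Fin (n + 1) → K))
    (f : MvPolynomial (Fin (n + 1)) K) (u v : Fin (n + 1) → K) :
    hess f u v = ∑ i, ∑ j, b.repr u i * b.repr v j * hess f (b i) (b j) := by
  rw [← hess_sum, b.sum_repr, b.sum_repr]

theorem hess_rep_self_of_mem {V : Set (PSpace K n)} {f : MvPolynomial (Fin (n + 1)) K}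
    (hf : f ∈ degreePart (idealOf V) 2) {P : PSpace K n} (hP : P ∈ V) :
    hess f P.rep P.rep = 0 := by
  rw [mem_degreePart_idealOf] at hf
  rw [hess_self hf.1, hf.2 P hP, mul_zero]

theorem degreePart_inf_le (I J : Ideal (MvPolynomial (Fin (n + 1)) K)) (d : ℕ) :
    degreePart (I ⊓ J) d ≤ degreePart I d := fun _ hf => ⟨hf.1.1, hf.2⟩

/-- The linear form with given values. -/
noncomputable def linForm (φ : Dual K (Fin (n + 1) → K)) : MvPolynomial (Fin (n + 1)) K :=
  ∑ j, C (φ (Pi.single j 1)) * X j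

theorem eval_linForm (φ : Dual K (Fin (n + 1) → K)) (x : Fin (n + 1) → K) :
    eval x (linForm φ) = φ x := by
  conv_rhs => rw [pi_eq_sum_univ' x]
  simp [linForm, mul_comm]

theorem isHomogeneous_linForm (φ : Dual K (Fin (n + 1) → K)) : (linForm φ).IsHomogeneous 1 :=
  IsHomogeneous.sum _ _ _ fun _ _ => by
    simpa using (isHomogeneous_C _ _).mul (isHomogeneous_X K _)

end Basis

/-! ### Consequences of the cone property in space -/

section Space

variable {K : Type*} [Field K]

theorem exists_basis_of_isNondegenerate {Z : Set (PSpace K 3)} (hZ : IsNondegenerate Z) :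
    ∃ b : Basis (Fin 4) K (Fin (3 + 1) → K), ∀ i, ∃ Q ∈ Z, Q.rep = b i := by
  have hspan : ⊤ ≤ Submodule.span K (Projectivization.rep '' Z) := by
    by_contra h
    obtain ⟨φ, hφ, hle⟩ := Submodule.exists_le_ker_of_lt_top _ (lt_top_iff_ne_top.mpr
      fun h' => h h'.ge)
    refine hZ ⟨LinearMap.ker φ, ?_, fun P hP => ?_⟩
    · have := Module.Dual.finrank_ker_add_one_of_ne_zero hφ
      rw [finrank_fin_fun] at this
      omega
    · exact liesOn_iff.mpr (hle (Submodule.subset_span ⟨P, hP, rfl⟩))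
  let b := Basis.ofSpan hspan
  have hb := Basis.ofSpan_subset hspan
  have hfin : Finite _ := Module.Finite.finite_basis b
  let e := Finite.equivFin ((linearIndepOn_empty K id).extend
    (Set.empty_subset (Projectivization.rep '' Z)))
  have hc : Nat.card ((linearIndepOn_empty K id).extend
    (Set.empty_subset (Projectivization.rep '' Z))) = 4 := by
    rw [← finrank_eq_nat_card_basis b, finrank_fin_fun]
  refine ⟨b.reindex (e.trans (finCongr hc)), fun i => ?_⟩
  rw [Basis.reindex_apply]
  obtain ⟨Q, hQ, h⟩ := hb ⟨_, rfl⟩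
  exact ⟨Q, hQ, h⟩

/-- The expected codimension is `(4).choose 3 = 4`; the maximum splits into the existence of a cone
and a strict dimension inequality, written without subtraction. -/
theorem unexpectedConeProperty_two_iff {Z : Set (PSpace K 3)} :
    UnexpectedConeProperty Z 2 ↔ ∃ U : Set (PSpace K 3), IsZariskiOpen U ∧ U.Nonempty ∧ ∀ P ∈ U,
      0 < finrank K (degreePart (idealOf Z ⊓ idealOf {P} ^ 2) 2) ∧
      finrank K (degreePart (idealOf Z) 2) <
        finrank K (degreePart (idealOf Z ⊓ idealOf {P} ^ 2) 2) + 4 := by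
  have h : (2 - 1 + 3).choose 3 = 4 := by decide
  simp only [UnexpectedConeProperty, AdmitsUnexpected, ForGeneralPoint, max_lt_iff, dimPart, h]
  refine exists_congr fun U => and_congr_right' <| and_congr_right' <| forall₂_congr fun P _ => ?_
  omega

variable [CharZero K]

/-- Only the existence of some cone at a general vertex is used. Were the Weddle form nonzero, a
general vertex could be chosen off its surface and off the coordinate planes, contradicting
`weddle_eq_zero_of_cone`. -/
theorem weddle_eq_zero_of_unexpectedConeProperty {Z : Set (PSpace K 3)}
    (hC : UnexpectedConeProperty Z 2) (b : Basis (Fin 4) K (Fin (3 + 1) → K))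
    (hb : ∀ i, ∃ Q ∈ Z, Q.rep = b i) {P Q : PSpace K 3} (hP : P ∈ Z) (hQ : Q ∈ Z)
    (p : Fin 4 → K) : weddle (b.repr P.rep) (b.repr Q.rep) p = 0 := by
  obtain ⟨U, hU, hne, h⟩ := unexpectedConeProperty_two_iff.mp hC
  let g : MvPolynomial (Fin 4) K :=
    weddle (fun i => C (b.repr P.rep i)) (fun i => C (b.repr Q.rep i)) X
  suffices hg : g = 0 by rw [← eval_weddle]; change eval p g = 0; rw [hg, map_zero]
  by_contra hg
  have hG : (∏ i, X i) * g ≠ 0 := mul_ne_zero (Finset.prod_ne_zero_iff.mpr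
    fun i _ => X_ne_zero i) hg
  obtain ⟨p, R, hR, c, hRp, hc, hp⟩ := exists_mem_of_isZariskiOpen hU hne b hG 0
  rw [map_mul, map_prod] at hp
  simp only [eval_X] at hp
  have hp0 : ∀ i, p i ≠ 0 := fun i =>
    Finset.prod_ne_zero_iff.mp (left_ne_zero_of_mul hp) i (Finset.mem_univ i)
  apply right_ne_zero_of_mul hp
  rw [eval_weddle]
  have := Module.finrank_pos_iff.mp (h R hR).1
  obtain ⟨⟨f, hf⟩, hf0⟩ := exists_ne (0 : degreePart (idealOf Z ⊓ idealOf {R} ^ 2) 2)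
  have hfZ := degreePart_inf_le _ _ _ hf
  have hvan : ∀ T ∈ Z, ∑ i, ∑ j, b.repr T.rep i * b.repr T.rep j * hess f (b i) (b j) = 0 :=
    fun T hT => by rw [← hess_eq_sum_repr, hess_rep_self_of_mem hfZ hT]
  refine weddle_eq_zero_of_cone (a := fun i j => hess f (b i) (b j)) (fun i j => hess_comm _ _ _)
    (fun i => ?_) ?_ hp0 (fun i => ?_) (hvan P hP) (hvan Q hQ)
  · obtain ⟨T, hT, hTb⟩ := hb i
    simp only [← hTb]
    exact hess_rep_self_of_mem hfZ hT
  · by_contra! hz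
    exact hf0 (Subtype.ext (eq_zero_of_hess_basis b hf.2 hz))
  · have h1 := hess_rep_of_mem_sq hf.2 hf.1.2 (b i)
    rw [hess_comm, hRp] at h1
    simpa [hc, mul_comm] using h1

/-- A cone with general vertex through the coordinate points and a further point of a coordinate
line is one of a pencil. -/
theorem finrank_cone_le_one {Z : Set (PSpace K 3)} (b : Basis (Fin 4) K (Fin (3 + 1) → K))
    (hb : ∀ i, ∃ Q ∈ Z, Q.rep = b i) {P R : PSpace K 3} (hP : P ∈ Z)
    (h0 : b.repr P.rep 0 ≠ 0) (h1 : b.repr P.rep 1 ≠ 0) (h2 : b.repr P.rep 2 = 0)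
    (h3 : b.repr P.rep 3 = 0) {p : Fin 4 → K} (hp : ∀ i, p i ≠ 0) {c : K} (hc : c ≠ 0)
    (hR : R.rep = c • ∑ i, p i • b i) :
    finrank K (degreePart (idealOf Z ⊓ idealOf {R} ^ 2) 2) ≤ 1 := by
  let φ : degreePart (idealOf Z ⊓ idealOf {R} ^ 2) 2 →ₗ[K] K :=
    { toFun := fun f => hess (f : MvPolynomial (Fin (3 + 1)) K) (b 0) (b 2)
      map_add' := fun f g => by simp
      map_smul' := fun c f => by simp }
  have hφ : Function.Injective φ := by
    rw [injective_iff_map_eq_zero]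
    rintro ⟨f, hf⟩ h
    have h02 : hess f (b 0) (b 2) = 0 := h
    have hfZ := degreePart_inf_le _ _ _ hf
    refine Subtype.ext (eq_zero_of_hess_basis b hf.2 ?_)
    have hs : ∀ i j, hess f (b i) (b j) = hess f (b j) (b i) := fun i j => hess_comm _ _ _
    have hd : ∀ i, hess f (b i) (b i) = 0 := fun i => by
      obtain ⟨T, hT, hTb⟩ := hb i
      simp only [← hTb]
      exact hess_rep_self_of_mem hfZ hT
    have hcone : ∀ i, ∑ j, hess f (b i) (b j) * p j = 0 := fun i => by
      have h1 := hess_rep_of_mem_sq hf.2 hf.1.2 (b i)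
      rw [hess_comm, hR] at h1
      simpa [hc, mul_comm] using h1
    have hz := hess_eq_sum_repr b f P.rep P.rep
    rw [hess_rep_self_of_mem hfZ hP] at hz
    simp only [Fin.sum_univ_four, h2, h3, hd, hs 1 0] at hz
    -- Passing through a third point of the edge 01 kills one of the two parameters of the pencil,
    -- so the entry at 02 determines the cone.
    have h01 : hess f (b 0) (b 1) = 0 := by
      have : 2 * (b.repr P.rep 0 * b.repr P.rep 1 * hess f (b 0) (b 1)) = 0 := by
        linear_combination -hz
      simpa [h0, h1] using this
    obtain ⟨e1, e2, e3, e4⟩ :=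
      cone_matrix_opposite (a := fun i j => hess f (b i) (b j)) hs hd hcone
    have h03 : hess f (b 0) (b 3) = 0 := by simpa [hp, h01, h02] using e4
    have h23 : hess f (b 2) (b 3) = 0 := by simpa [hp, h01] using e1
    have h13 : hess f (b 1) (b 3) = 0 := by simpa [hp, h02] using e2
    have h12 : hess f (b 1) (b 2) = 0 := by simpa [hp, h03] using e3
    intro i j
    fin_cases i <;> fin_cases j <;>
      simp [hs 1 0, hs 2 0, hs 3 0, hs 2 1, hs 3 1, hs 3 2, hd, h01, h02, h03, h12, h13, h23]
  simpa using LinearMap.finrank_le_finrank_of_injective hφ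

omit [CharZero K] in
theorem eval_linForm_coord (b : Basis (Fin 4) K (Fin (3 + 1) → K)) (i : Fin 4)
    (x : Fin (3 + 1) → K) : eval x (linForm (b.coord i)) = b.repr x i := by
  rw [eval_linForm, Basis.coord_apply]

/-- A coordinate line and the two opposite coordinate points impose at most five conditions on
quadrics. -/
theorem five_le_finrank {Z : Set (PSpace K 3)} (b : Basis (Fin 4) K (Fin (3 + 1) → K))
    (h : ∀ P ∈ Z, (b.repr P.rep 2 = 0 ∧ b.repr P.rep 3 = 0) ∨ P.rep = b 2 ∨ P.rep = b 3) :
    5 ≤ finrank K (degreePart (idealOf Z) 2) := by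
  let ξ : Fin 4 → MvPolynomial (Fin (3 + 1)) K := fun i => linForm (b.coord i)
  let v : Fin 5 → MvPolynomial (Fin (3 + 1)) K :=
    ![ξ 0 * ξ 2, ξ 0 * ξ 3, ξ 1 * ξ 2, ξ 1 * ξ 3, ξ 2 * ξ 3]
  have hξ : ∀ i j, (ξ i * ξ j).IsHomogeneous 2 := fun i j =>
    (isHomogeneous_linForm _).mul (isHomogeneous_linForm _)
  have hev : ∀ i x, eval x (ξ i) = b.repr x i := fun i x => eval_linForm_coord b i x
  have hv : ∀ i, v i ∈ degreePart (idealOf Z) 2 := by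
    intro i
    rw [mem_degreePart_idealOf]
    constructor
    · fin_cases i <;> exact hξ _ _
    · intro P hP
      rcases h P hP with ⟨h2, h3⟩ | h2 | h2
      · fin_cases i <;> simp [v, hev, h2, h3]
      · fin_cases i <;> simp [v, hev, h2]
      · fin_cases i <;> simp [v, hev, h2]
  let Ψ : (Fin 5 → K) →ₗ[K] degreePart (idealOf Z) 2 :=
    LinearMap.codRestrict _ (Fintype.linearCombination K v) fun c => by
      rw [Fintype.linearCombination_apply]
      exact Submodule.sum_mem _ fun i _ => Submodule.smul_mem _ _ (hv i)
  have hΨ : Function.Injective Ψ := by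
    rw [injective_iff_map_eq_zero]
    intro c hc
    have hc' : Fintype.linearCombination K v c = 0 := congrArg Subtype.val hc
    rw [Fintype.linearCombination_apply] at hc'
    -- At `b i + b j` the only product of coordinates that survives is the one of index `i`, `j`, so
    -- these values read off the coefficients one by one.
    have hx : ∀ i j, eval (b i + b j) (∑ k, c k • v k) = 0 := fun i j => by rw [hc', map_zero]
    have e0 := hx 0 2
    have e1 := hx 0 3
    have e2 := hx 1 2
    have e3 := hx 1 3
    have e4 := hx 2 3
    simp [Fin.sum_univ_five, v, hev, smul_eval] at e0 e1 e2 e3 e4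
    funext k
    fin_cases k <;> assumption
  simpa using LinearMap.finrank_le_finrank_of_injective hΨ

end Space

/-! ### From the cone property to two skew lines -/

section Classification

variable {K : Type*} [Field K]

theorem mem_span_pair_of_repr (b : Basis (Fin 4) K (Fin (3 + 1) → K)) {x : Fin (3 + 1) → K}
    {i j k l : Fin 4} (hu : (Finset.univ : Finset (Fin 4)) = {i, j, k, l}) (hk : b.repr x k = 0)
    (hl : b.repr x l = 0) : x ∈ Submodule.span K {b i, b j} := by
  rw [← b.sum_repr x]
  refine Submodule.sum_mem _ fun m _ => ?_
  have hm : m ∈ ({i, j, k, l} : Finset (Fin 4)) := hu ▸ Finset.mem_univ m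
  simp only [Finset.mem_insert, Finset.mem_singleton] at hm
  rcases hm with rfl | rfl | rfl | rfl
  · exact Submodule.smul_mem _ _ (Submodule.subset_span (by simp))
  · exact Submodule.smul_mem _ _ (Submodule.subset_span (by simp))
  · rw [hk, zero_smul]; exact zero_mem _
  · rw [hl, zero_smul]; exact zero_mem _

theorem repr_eq_zero_of_mem_span_pair (b : Basis (Fin 4) K (Fin (3 + 1) → K))
    {x : Fin (3 + 1) → K} {i j k : Fin 4} (hi : i ≠ k) (hj : j ≠ k)
    (hx : x ∈ Submodule.span K {b i, b j}) : b.repr x k = 0 := by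
  have h : Submodule.span K {b i, b j} ≤ LinearMap.ker (b.coord k) := by
    rw [Submodule.span_le]
    rintro y (rfl | rfl) <;> simp [hi, hj]
  exact h hx

theorem isLine_span_pair (b : Basis (Fin 4) K (Fin (3 + 1) → K)) {i j : Fin 4} (hij : i ≠ j) :
    IsLine (Submodule.span K {b i, b j}) := by
  have h : LinearIndependent K ![b i, b j] := by
    have := b.linearIndependent.comp ![i, j] (by
      intro x y hxy
      fin_cases x <;> fin_cases y <;> simp_all [eq_comm])
    convert this using 1
    funext x
    fin_cases x <;> rfl
  have h2 := finrank_span_eq_card h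
  rwa [Matrix.range_cons, Matrix.range_cons, Matrix.range_empty, Set.union_empty,
    Set.singleton_union, Fintype.card_fin] at h2

theorem areSkew_span_pair (b : Basis (Fin 4) K (Fin (3 + 1) → K)) :
    AreSkew (Submodule.span K {b 0, b 1}) (Submodule.span K {b 2, b 3}) := by
  rintro P ⟨h1, h2⟩
  rw [liesOn_iff] at h1 h2
  apply P.rep_nonzero
  apply b.repr.injective
  rw [map_zero]
  ext i
  fin_cases i
  · exact repr_eq_zero_of_mem_span_pair b (by decide) (by decide) h2
  · exact repr_eq_zero_of_mem_span_pair b (by decide) (by decide) h2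
  · exact repr_eq_zero_of_mem_span_pair b (by decide) (by decide) h1
  · exact repr_eq_zero_of_mem_span_pair b (by decide) (by decide) h1

theorem exists_repr_ne_zero_of_ne {b : Basis (Fin 4) K (Fin (3 + 1) → K)} {Q : Fin 4 → PSpace K 3}
    (hQ : ∀ i, (Q i).rep = b i) {P : PSpace K 3} (hP : ∀ i, P ≠ Q i) (l : Fin 4) :
    ∃ i, i ≠ l ∧ b.repr P.rep i ≠ 0 := by
  by_contra! h
  apply rep_ne_smul_rep (hP l) (b.repr P.rep l)
  rw [hQ]
  conv_lhs => rw [← b.sum_repr P.rep]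
  exact Finset.sum_eq_single l (fun i _ hi => by rw [h i hi, zero_smul]) (by simp)

variable [CharZero K]

theorem exists_skew_lines_of_basis {Z : Finset (PSpace K 3)}
    (hC : UnexpectedConeProperty (Z : Set (PSpace K 3)) 2)
    (b : Basis (Fin 4) K (Fin (3 + 1) → K)) {Q : Fin 4 → PSpace K 3} (hQZ : ∀ i, Q i ∈ Z)
    (hQ : ∀ i, (Q i).rep = b i) {P P' : PSpace K 3} (hP : P ∈ Z) (hPQ : ∀ i, P ≠ Q i)
    (hP' : P' ∈ Z) (hPQ' : ∀ i, P' ≠ Q i) (hPP' : P' ≠ P)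
    (h0 : b.repr P.rep 0 ≠ 0) (h1 : b.repr P.rep 1 ≠ 0) :
    ∃ L₁ L₂ : Submodule K (Fin (3 + 1) → K), IsLine L₁ ∧ IsLine L₂ ∧ AreSkew L₁ L₂ ∧
      (∀ P ∈ Z, LiesOn P L₁ ∨ LiesOn P L₂) ∧
      3 ≤ {P | P ∈ Z ∧ LiesOn P L₁}.ncard ∧ 3 ≤ {P | P ∈ Z ∧ LiesOn P L₂}.ncard := by
  have hb : ∀ i, ∃ T ∈ (Z : Set (PSpace K 3)), T.rep = b i := fun i => ⟨Q i, hQZ i, hQ i⟩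
  have hQinj : ∀ i j, i ≠ j → Q i ≠ Q j := fun i j hij h =>
    hij (b.injective (by rw [← hQ, ← hQ, h]))
  have main : ∀ T ∈ Z, (∀ i, T ≠ Q i) → T ≠ P →
      (b.repr P.rep 2 = 0 ∧ b.repr P.rep 3 = 0) ∧
        ((b.repr T.rep 2 = 0 ∧ b.repr T.rep 3 = 0) ∨
          (b.repr T.rep 0 = 0 ∧ b.repr T.rep 1 = 0)) := by
    intro T hT hTQ hTP
    refine support_of_weddle (fun l j k hj hk => weddle_coeff
      (weddle_eq_zero_of_unexpectedConeProperty hC b hb hP hT) hj hk) (fun c => ?_)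
      (exists_repr_ne_zero_of_ne hQ hTQ) h0 h1
    by_contra! h
    apply rep_ne_smul_rep hTP c
    apply b.repr.injective
    ext i
    simpa using h i
  obtain ⟨⟨h2, h3⟩, -⟩ := main P' hP' hPQ' hPP'
  have u1 : (Finset.univ : Finset (Fin 4)) = {0, 1, 2, 3} := by decide
  have u2 : (Finset.univ : Finset (Fin 4)) = {2, 3, 0, 1} := by decide
  have on1 : ∀ T : PSpace K 3, b.repr T.rep 2 = 0 ∧ b.repr T.rep 3 = 0 →
      LiesOn T (Submodule.span K {b 0, b 1}) := fun T hT =>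
    liesOn_iff.mpr (mem_span_pair_of_repr b u1 hT.1 hT.2)
  have on2 : ∀ T : PSpace K 3, b.repr T.rep 0 = 0 ∧ b.repr T.rep 1 = 0 →
      LiesOn T (Submodule.span K {b 2, b 3}) := fun T hT =>
    liesOn_iff.mpr (mem_span_pair_of_repr b u2 hT.1 hT.2)
  have hQ0 := on1 (Q 0) (by simp [hQ])
  have hQ1 := on1 (Q 1) (by simp [hQ])
  have hQ2 := on2 (Q 2) (by simp [hQ])
  have hQ3 := on2 (Q 3) (by simp [hQ])
  have hfin : ∀ L : Submodule K (Fin (3 + 1) → K), {P | P ∈ Z ∧ LiesOn P L}.Finite := fun L =>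
    Z.finite_toSet.subset fun T hT => hT.1
  -- The third point on the second line. Without it `Z` would lie on the edge 01 together with two
  -- coordinate points, and 5 < 1 + 4 would be required; this is the only use of the strict
  -- dimension inequality.
  obtain ⟨w, hw, hwQ, hwP, hw01⟩ : ∃ w ∈ Z, (∀ i, w ≠ Q i) ∧ w ≠ P ∧
      (b.repr w.rep 0 = 0 ∧ b.repr w.rep 1 = 0) := by
    by_contra! hno
    obtain ⟨U, hU, hne, h⟩ := unexpectedConeProperty_two_iff.mp hC
    have hX : (∏ i, X i : MvPolynomial (Fin 4) K) ≠ 0 :=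
      Finset.prod_ne_zero_iff.mpr fun i _ => X_ne_zero i
    obtain ⟨p, R, hR, c, hRp, hc, hp⟩ := exists_mem_of_isZariskiOpen hU hne b hX 0
    rw [map_prod] at hp
    simp only [eval_X] at hp
    have hle := finrank_cone_le_one b hb (P := P) hP h0 h1 h2 h3
      (fun i => Finset.prod_ne_zero_iff.mp hp i (Finset.mem_univ i)) hc hRp
    have hge : 5 ≤ finrank K (degreePart (idealOf (Z : Set (PSpace K 3))) 2) := by
      refine five_le_finrank b fun T hT => ?_
      by_cases hTQ : ∀ i, T ≠ Q i
      · rcases eq_or_ne T P with rfl | hTP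
        · exact Or.inl ⟨h2, h3⟩
        · rcases (main T hT hTQ hTP).2 with hT' | hT'
          · exact Or.inl hT'
          · exact absurd hT'.2 (hno T hT hTQ hTP hT'.1)
      · push Not at hTQ
        obtain ⟨i, rfl⟩ := hTQ
        rw [hQ]
        fin_cases i <;> simp
    have := (h R hR).2
    omega
  refine ⟨_, _, isLine_span_pair b (by decide), isLine_span_pair b (by decide),
    areSkew_span_pair b, fun T hT => ?_, ?_, ?_⟩
  · by_cases hTQ : ∀ i, T ≠ Q i
    · rcases eq_or_ne T P with rfl | hTP
      · exact Or.inl (on1 _ ⟨h2, h3⟩)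
      · exact (main T hT hTQ hTP).2.imp (on1 T) (on2 T)
    · push Not at hTQ
      obtain ⟨i, rfl⟩ := hTQ
      fin_cases i
      · exact Or.inl hQ0
      · exact Or.inl hQ1
      · exact Or.inr hQ2
      · exact Or.inr hQ3
  · exact (Set.two_lt_ncard (hfin _)).mpr ⟨Q 0, ⟨hQZ 0, hQ0⟩, Q 1, ⟨hQZ 1, hQ1⟩, P,
      ⟨hP, on1 _ ⟨h2, h3⟩⟩, hQinj _ _ (by decide), (hPQ 0).symm, (hPQ 1).symm⟩
  · exact (Set.two_lt_ncard (hfin _)).mpr ⟨Q 2, ⟨hQZ 2, hQ2⟩, Q 3, ⟨hQZ 3, hQ3⟩, w,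
      ⟨hw, on2 _ hw01⟩, hQinj _ _ (by decide), (hwQ 2).symm, (hwQ 3).symm⟩

theorem exists_skew_lines {Z : Finset (PSpace K 3)}
    (hZ : IsNondegenerate (Z : Set (PSpace K 3))) (hcard : 6 ≤ Z.card)
    (hC : UnexpectedConeProperty (Z : Set (PSpace K 3)) 2) :
    ∃ L₁ L₂ : Submodule K (Fin (3 + 1) → K), IsLine L₁ ∧ IsLine L₂ ∧ AreSkew L₁ L₂ ∧
      (∀ P ∈ Z, LiesOn P L₁ ∨ LiesOn P L₂) ∧
      3 ≤ {P | P ∈ Z ∧ LiesOn P L₁}.ncard ∧ 3 ≤ {P | P ∈ Z ∧ LiesOn P L₂}.ncard := by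
  classical
  obtain ⟨b, hb⟩ := exists_basis_of_isNondegenerate hZ
  choose Q hQZ hQ using hb
  have hlt : 1 < (Z \ Finset.univ.image Q).card := by
    have h1 := Finset.le_card_sdiff (Finset.univ.image Q) Z
    have h2 : (Finset.univ.image Q).card ≤ 4 := Finset.card_image_le
    omega
  obtain ⟨P, hP, P', hP', hne⟩ := Finset.one_lt_card.mp hlt
  simp only [Finset.mem_sdiff, Finset.mem_image, Finset.mem_univ, true_and, not_exists] at hP hP'
  have hPQ : ∀ i, P ≠ Q i := fun i h => hP.2 i h.symm
  have hPQ' : ∀ i, P' ≠ Q i := fun i h => hP'.2 i h.symm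
  -- A point other than the basis points has at least two nonzero coordinates; the basis is permuted
  -- so that they come first. The index 0 given here is arbitrary.
  obtain ⟨i, -, hi⟩ := exists_repr_ne_zero_of_ne hQ hPQ 0
  obtain ⟨j, hji, hj⟩ := exists_repr_ne_zero_of_ne hQ hPQ i
  obtain ⟨σ, rfl, rfl⟩ : ∃ σ : Equiv.Perm (Fin 4), σ 0 = i ∧ σ 1 = j := by
    have : ∀ i j : Fin 4, j ≠ i → ∃ σ : Equiv.Perm (Fin 4), σ 0 = i ∧ σ 1 = j := by decide
    exact this i j hji
  exact exists_skew_lines_of_basis hC (b.reindex σ.symm) (Q := Q ∘ σ) (fun i => hQZ _)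
    (fun i => by simp [hQ]) hP.1 (fun i => hPQ _) hP'.1 (fun i => hPQ' _) hne.symm
    (by simpa using hi) (by simpa using hj)

end Classification

/-! ### From two skew lines to the cone property -/

section Converse

variable {K : Type*} [Field K]

theorem linearIndependent_of_areSkew {L₁ L₂ : Submodule K (Fin (3 + 1) → K)}
    (hskew : AreSkew L₁ L₂) {Q : Fin 4 → PSpace K 3} (h0 : LiesOn (Q 0) L₁)
    (h1 : LiesOn (Q 1) L₁) (h2 : LiesOn (Q 2) L₂) (h3 : LiesOn (Q 3) L₂) (h01 : Q 0 ≠ Q 1)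
    (h23 : Q 2 ≠ Q 3) : LinearIndependent K fun i => (Q i).rep := by
  rw [liesOn_iff] at h0 h1 h2 h3
  have hpair : ∀ {P P' : PSpace K 3}, P ≠ P' → ∀ s t : K, s • P.rep + t • P'.rep = 0 →
      s = 0 ∧ t = 0 := by
    intro P P' hne s t h
    have := Projectivization.linearIndependent_pair_iff_ne.mpr hne
    rw [LinearIndependent.pair_iff] at this
    exact this s t h
  rw [Fintype.linearIndependent_iff]
  intro g hg
  rw [Fin.sum_univ_four, add_assoc] at hg
  -- A linear relation equates a vector of the first line with one of the second; a nonzero such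
  -- vector would be a common point.
  have hx : g 0 • (Q 0).rep + g 1 • (Q 1).rep = 0 := by
    by_contra hne
    apply hskew (Projectivization.mk K _ hne)
    simp only [LiesOn, Projectivization.submodule_mk, Submodule.span_singleton_le_iff_mem]
    refine ⟨add_mem (L₁.smul_mem _ h0) (L₁.smul_mem _ h1), ?_⟩
    rw [eq_neg_of_add_eq_zero_left hg]
    exact neg_mem (add_mem (L₂.smul_mem _ h2) (L₂.smul_mem _ h3))
  rw [hx, zero_add] at hg
  obtain ⟨g0, g1⟩ := hpair h01 _ _ hx
  obtain ⟨g2, g3⟩ := hpair h23 _ _ hg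
  intro i
  fin_cases i <;> assumption

theorem span_rep_pair_of_isLine {L : Submodule K (Fin (3 + 1) → K)} (hL : IsLine L)
    {P P' : PSpace K 3} (hP : LiesOn P L) (hP' : LiesOn P' L) (hne : P ≠ P') :
    L = Submodule.span K {P.rep, P'.rep} := by
  rw [liesOn_iff] at hP hP'
  symm
  apply Submodule.eq_of_le_of_finrank_eq
  · rw [Submodule.span_le]
    rintro x (rfl | rfl) <;> assumption
  · have h : LinearIndependent K ![P.rep, P'.rep] := by
      rw [LinearIndependent.pair_iff]
      have := Projectivization.linearIndependent_pair_iff_ne.mpr hne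
      rwa [LinearIndependent.pair_iff] at this
    have h2 := finrank_span_eq_card h
    rw [Matrix.range_cons, Matrix.range_cons, Matrix.range_empty, Set.union_empty,
      Set.singleton_union, Fintype.card_fin] at h2
    rw [h2, hL]

variable [CharZero K]

/-- A quadric containing three points of a line contains the line. -/
theorem hess_eq_zero_of_three_points {V : Set (PSpace K 3)} {L : Submodule K (Fin (3 + 1) → K)}
    (hL : IsLine L) {P₁ P₂ P₃ : PSpace K 3} (h1 : P₁ ∈ V ∧ LiesOn P₁ L) (h2 : P₂ ∈ V ∧ LiesOn P₂ L)
    (h3 : P₃ ∈ V ∧ LiesOn P₃ L) (h12 : P₁ ≠ P₂) (h13 : P₁ ≠ P₃) (h23 : P₂ ≠ P₃)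
    {f : MvPolynomial (Fin (3 + 1)) K} (hf : f ∈ degreePart (idealOf V) 2) :
    hess f P₁.rep P₂.rep = 0 := by
  have hspan := span_rep_pair_of_isLine hL h1.2 h2.2 h12
  have h3' := liesOn_iff.mp h3.2
  rw [hspan, Submodule.mem_span_pair] at h3'
  obtain ⟨s, t, hst⟩ := h3'
  have hs : s ≠ 0 := by
    rintro rfl
    rw [zero_smul, zero_add] at hst
    exact rep_ne_smul_rep h23.symm t hst.symm
  have ht : t ≠ 0 := by
    rintro rfl
    rw [zero_smul, add_zero] at hst
    exact rep_ne_smul_rep h13.symm s hst.symm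
  have h := hess_rep_self_of_mem hf h3.1
  rw [← hst] at h
  simp only [map_add, map_smul, LinearMap.add_apply, LinearMap.smul_apply, smul_eq_mul,
    hess_rep_self_of_mem hf h1.1, hess_rep_self_of_mem hf h2.1, hess_comm f P₂.rep P₁.rep] at h
  -- For `P₃ = s P₁ + t P₂` the isotropy of all three points leaves only the mixed term.
  have : 2 * (s * t * hess f P₁.rep P₂.rep) = 0 := by linear_combination h
  simpa [hs, ht] using this

theorem finrank_pos_of_mul_mem {I J : Ideal (MvPolynomial (Fin (3 + 1)) K)}
    {l₁ l₂ : MvPolynomial (Fin (3 + 1)) K} (h : l₁ * l₂ ∈ degreePart I 2) (h₁ : l₁ ∈ J)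
    (h₂ : l₂ ∈ J) (hl₁ : l₁ ≠ 0) (hl₂ : l₂ ≠ 0) : 0 < finrank K (degreePart (I ⊓ J ^ 2) 2) := by
  have hmem : l₁ * l₂ ∈ degreePart (I ⊓ J ^ 2) 2 :=
    ⟨⟨h.1, by rw [pow_two]; exact Ideal.mul_mem_mul h₁ h₂⟩, h.2⟩
  exact Module.finrank_pos_iff_exists_ne_zero.mpr
    ⟨⟨_, hmem⟩, fun h0 => mul_ne_zero hl₁ hl₂ (congrArg Subtype.val h0)⟩

/-- Quadrics through two opposite coordinate lines depend on at most four parameters. -/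
theorem finrank_le_four {I : Ideal (MvPolynomial (Fin (3 + 1)) K)}
    (b : Basis (Fin 4) K (Fin (3 + 1) → K))
    (diag : ∀ f ∈ degreePart I 2, ∀ i, hess f (b i) (b i) = 0)
    (line₁ : ∀ f ∈ degreePart I 2, hess f (b 0) (b 1) = 0)
    (line₂ : ∀ f ∈ degreePart I 2, hess f (b 2) (b 3) = 0) :
    finrank K (degreePart I 2) ≤ 4 := by
  let φ : degreePart (I) 2 →ₗ[K] Fin 4 → K :=
    { toFun := fun f => ![hess (f : MvPolynomial (Fin (3 + 1)) K) (b 0) (b 2),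
        hess (f : MvPolynomial (Fin (3 + 1)) K) (b 0) (b 3),
        hess (f : MvPolynomial (Fin (3 + 1)) K) (b 1) (b 2),
        hess (f : MvPolynomial (Fin (3 + 1)) K) (b 1) (b 3)]
      map_add' := fun f g => by ext i; fin_cases i <;> simp
      map_smul' := fun c f => by ext i; fin_cases i <;> simp }
  have hφ : Function.Injective φ := by
    rw [injective_iff_map_eq_zero]
    rintro ⟨f, hf⟩ h
    have e1 : hess f (b 0) (b 2) = 0 := congrFun h 0
    have e2 : hess f (b 0) (b 3) = 0 := congrFun h 1
    have e3 : hess f (b 1) (b 2) = 0 := congrFun h 2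
    have e4 : hess f (b 1) (b 3) = 0 := congrFun h 3
    have hs : ∀ i j, hess f (b i) (b j) = hess f (b j) (b i) := fun i j => hess_comm _ _ _
    have hd := diag f hf
    have e5 := line₁ f hf
    have e6 := line₂ f hf
    refine Subtype.ext (eq_zero_of_hess_basis b hf.2 ?_)
    intro i j
    fin_cases i <;> fin_cases j <;>
      simp [hs 1 0, hs 2 0, hs 3 0, hs 2 1, hs 3 1, hs 3 2, hd, e1, e2, e3, e4, e5, e6]
  simpa using LinearMap.finrank_le_finrank_of_injective hφ

theorem unexpectedConeProperty_of_skew_lines {Z : Set (PSpace K 3)}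
    {L₁ L₂ : Submodule K (Fin (3 + 1) → K)} (hL₁ : IsLine L₁) (hL₂ : IsLine L₂)
    (hskew : AreSkew L₁ L₂) (hcov : ∀ P ∈ Z, LiesOn P L₁ ∨ LiesOn P L₂)
    {Q : Fin 4 → PSpace K 3} {T₁ T₂ : PSpace K 3}
    (h0 : Q 0 ∈ Z ∧ LiesOn (Q 0) L₁) (h1 : Q 1 ∈ Z ∧ LiesOn (Q 1) L₁) (hT₁ : T₁ ∈ Z ∧ LiesOn T₁ L₁)
    (h2 : Q 2 ∈ Z ∧ LiesOn (Q 2) L₂) (h3 : Q 3 ∈ Z ∧ LiesOn (Q 3) L₂) (hT₂ : T₂ ∈ Z ∧ LiesOn T₂ L₂)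
    (h01 : Q 0 ≠ Q 1) (h0T : Q 0 ≠ T₁) (h1T : Q 1 ≠ T₁)
    (h23 : Q 2 ≠ Q 3) (h2T : Q 2 ≠ T₂) (h3T : Q 3 ≠ T₂) :
    UnexpectedConeProperty Z 2 := by
  have hli := linearIndependent_of_areSkew hskew h0.2 h1.2 h2.2 h3.2 h01 h23
  let b : Basis (Fin 4) K (Fin (3 + 1) → K) :=
    basisOfLinearIndependentOfCardEqFinrank hli (by simp)
  have hb : ∀ i, b i = (Q i).rep := fun i => by simp [b]
  have hQZ : ∀ i, Q i ∈ Z := by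
    intro i
    fin_cases i
    exacts [h0.1, h1.1, h2.1, h3.1]
  have hle : finrank K (degreePart (idealOf Z) 2) ≤ 4 := by
    refine finrank_le_four b (fun f hf i => ?_) (fun f hf => ?_) fun f hf => ?_
    · rw [hb]
      exact hess_rep_self_of_mem hf (hQZ i)
    · rw [hb, hb]
      exact hess_eq_zero_of_three_points hL₁ h0 h1 hT₁ h01 h0T h1T hf
    · rw [hb, hb]
      exact hess_eq_zero_of_three_points hL₂ h2 h3 hT₂ h23 h2T h3T hf
  -- Supplies a plane through `R` and a given line, including the case of `R` on that line, so no
  -- vertex has to be excluded and all of space serves as the open set.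
  have hrel : ∀ s t : K, ∃ x y : K, (x ≠ 0 ∨ y ≠ 0) ∧ x * s + y * t = 0 := by
    intro s t
    by_cases hs : s = 0
    · exact ⟨1, 0, Or.inl one_ne_zero, by simp [hs]⟩
    · exact ⟨-t, s, Or.inr hs, by ring⟩
  refine unexpectedConeProperty_two_iff.mpr ⟨Set.univ, ⟨{1}, ?_, ?_⟩, ⟨Q 0, trivial⟩, fun R _ => ?_⟩
  · rintro f rfl
    exact ⟨0, isHomogeneous_one _ _⟩
  · ext P
    simp [VanishesAt]
  suffices h : 0 < finrank K (degreePart (idealOf Z ⊓ idealOf {R} ^ 2) 2) from ⟨h, by omega⟩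
  obtain ⟨x, y, hxy, hr1⟩ := hrel (b.repr R.rep 0) (b.repr R.rep 1)
  obtain ⟨z, w, hzw, hr2⟩ := hrel (b.repr R.rep 2) (b.repr R.rep 3)
  -- `l₁` cuts out a plane containing `L₂` and `R`, `l₂` one containing `L₁` and `R`; their product
  -- is the required cone.
  let l₁ := linForm (x • b.coord 0 + y • b.coord 1)
  let l₂ := linForm (z • b.coord 2 + w • b.coord 3)
  have ev1 : ∀ u, eval u l₁ = x * b.repr u 0 + y * b.repr u 1 := fun u => by
    simp [l₁, eval_linForm]
  have ev2 : ∀ u, eval u l₂ = z * b.repr u 2 + w * b.repr u 3 := fun u => by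
    simp [l₂, eval_linForm]
  have hl₁ : l₁ ≠ 0 := fun h => by
    have e0 := ev1 (b 0)
    have e1 := ev1 (b 1)
    rw [h] at e0 e1
    simp at e0 e1
    exact hxy.elim (fun hx => hx e0.symm) fun hy => hy e1.symm
  have hl₂ : l₂ ≠ 0 := fun h => by
    have e0 := ev2 (b 2)
    have e1 := ev2 (b 3)
    rw [h] at e0 e1
    simp at e0 e1
    exact hzw.elim (fun hx => hx e0.symm) fun hy => hy e1.symm
  have hhom : (l₁ * l₂).IsHomogeneous 2 := (isHomogeneous_linForm _).mul (isHomogeneous_linForm _)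
  have hs₁ := span_rep_pair_of_isLine hL₁ h0.2 h1.2 h01
  have hs₂ := span_rep_pair_of_isLine hL₂ h2.2 h3.2 h23
  rw [← hb, ← hb] at hs₁ hs₂
  have hZmem : l₁ * l₂ ∈ degreePart (idealOf Z) 2 := by
    refine mem_degreePart_idealOf.mpr ⟨hhom, fun P hP => ?_⟩
    rw [map_mul, ev1, ev2]
    rcases hcov P hP with h | h
    · rw [liesOn_iff, hs₁] at h
      rw [repr_eq_zero_of_mem_span_pair b (k := 2) (by decide) (by decide) h,
        repr_eq_zero_of_mem_span_pair b (k := 3) (by decide) (by decide) h]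
      ring
    · rw [liesOn_iff, hs₂] at h
      rw [repr_eq_zero_of_mem_span_pair b (k := 0) (by decide) (by decide) h,
        repr_eq_zero_of_mem_span_pair b (k := 1) (by decide) (by decide) h]
      ring
  have hl₁R : l₁ ∈ idealOf {R} := Ideal.subset_span ⟨⟨1, isHomogeneous_linForm _⟩, by
    rintro P rfl
    rw [VanishesAt, ev1, hr1]⟩
  have hl₂R : l₂ ∈ idealOf {R} := Ideal.subset_span ⟨⟨1, isHomogeneous_linForm _⟩, by
    rintro P rfl
    rw [VanishesAt, ev2, hr2]⟩
  exact finrank_pos_of_mul_mem hZmem hl₁R hl₂R hl₁ hl₂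

end Converse

end UnexpectedCones

theorem proposition4p3 {K : Type*} [Field K] [CharZero K]
    (Z : Finset (UnexpectedCones.PSpace K 3))
    (hZ : UnexpectedCones.IsNondegenerate (Z : Set (UnexpectedCones.PSpace K 3)))
    (hcard : 6 ≤ Z.card) :
    UnexpectedCones.UnexpectedConeProperty (Z : Set (UnexpectedCones.PSpace K 3)) 2 ↔
      ∃ L₁ L₂ : Submodule K (Fin (3 + 1) → K),
        UnexpectedCones.IsLine L₁ ∧ UnexpectedCones.IsLine L₂ ∧
        UnexpectedCones.AreSkew L₁ L₂ ∧
        (∀ P ∈ Z, UnexpectedCones.LiesOn P L₁ ∨ UnexpectedCones.LiesOn P L₂) ∧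
        3 ≤ {P | P ∈ Z ∧ UnexpectedCones.LiesOn P L₁}.ncard ∧
        3 ≤ {P | P ∈ Z ∧ UnexpectedCones.LiesOn P L₂}.ncard := by
  refine ⟨UnexpectedCones.exists_skew_lines hZ hcard, ?_⟩
  rintro ⟨L₁, L₂, hL₁, hL₂, hskew, hcov, hn₁, hn₂⟩
  have hfin : ∀ L : Submodule K (Fin (3 + 1) → K),
      {P | P ∈ Z ∧ UnexpectedCones.LiesOn P L}.Finite := fun L =>
    Z.finite_toSet.subset fun T hT => hT.1
  obtain ⟨P₀, h0, P₁, h1, T₁, hT₁, h01, h0T, h1T⟩ := (Set.two_lt_ncard (hfin L₁)).mp hn₁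
  obtain ⟨P₂, h2, P₃, h3, T₂, hT₂, h23, h2T, h3T⟩ := (Set.two_lt_ncard (hfin L₂)).mp hn₂
  exact UnexpectedCones.unexpectedConeProperty_of_skew_lines hL₁ hL₂ hskew hcov
    (Q := ![P₀, P₁, P₂, P₃]) h0 h1 hT₁ h2 h3 hT₂ h01 h0T h1T h23 h2T h3T
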